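/- Let $k/k_0$ be a quadratic extension of number fields, let $L/k$ be a finite Galois extension with Galois group $G$, and assume $L\subseteq\mathbb{C}$ (so $k_0\subseteq k\subseteq L\subseteq\mathbb{C}$). Assume that the nontrivial $k_0$-automorphism of $k$ is complex conjugation and that complex conjugation induces an automorphism $\alpha$ of $L$. Let $\xi\colon G\times G\to L^\times$ be a $2$-cocycle with $\alpha(\xi_{\sigma,\rho})\,\xi_{\sigma,\rho}=1$ for all $\sigma,\rho\in G$, and let $B=(\xi,L/k,G)$ be the crossed product algebra, i.e. $B=\bigoplus_{\sigma\in G}L u_\sigma$ with $u_\sigma a=\sigma(a)u_\sigma$ for $a\in L$ and $u_\sigma u_\rho=\xi_{\sigma,\rho}u_{\sigma\rho}$. Assume that $B$ is a division algebra. A unitary involution $\tau$ on $B$ (a ring anti-automorphism of $B$ with $\tau^2=\mathrm{id}$ whose restriction to $k$ is complex conjugation) is called positive if $\mathrm{Trd}_B(\tau(x)x)>0$ for all $x\in B\setminus\{0\}$, where $\mathrm{Trd}_B\colon B\to k$ is the reduced trace; here $\mathrm{Trd}_B(\tau(x)x)\in k_0\subseteq\mathbb{R}$. If $B$ carries a positive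 unitary involution $\tau$ with $\tau|_L=\alpha$, then $\alpha\circ\sigma=\sigma\circ\alpha$ for every $\sigma\in G$. -/

import Mathlib

open groupCohomology
open scoped TensorProduct

/-- The crossed product `(ξ, L/F, Gal(L/F))` attached to a multiplicative `2`-cocycle `ξ` of
`Gal(L/F)` with values in `Lˣ`: the left `L`-vector space with basis `(u_σ)` indexed by the Galois
group.  An element `∑ σ, x_σ u_σ` is represented by its coefficient function `σ ↦ x_σ`.
The multiplication is determined by `u_σ a = σ(a) u_σ` and `u_σ u_ρ = ξ(σ, ρ) u_{σρ}`;
the cocycle is not assumed to be normalized. -/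
def CrossedProduct {F L : Type*} [Field F] [Field L] [Algebra F L]
    {ξ : (L ≃ₐ[F] L) × (L ≃ₐ[F] L) → Lˣ} (_hξ : IsMulCocycle₂ ξ) : Type _ :=
  (L ≃ₐ[F] L) → L

namespace CrossedProduct

section

variable {F L : Type*} [Field F] [Field L] [Algebra F L]
  {ξ : (L ≃ₐ[F] L) × (L ≃ₐ[F] L) → Lˣ} (hξ : IsMulCocycle₂ ξ)

instance : AddCommGroup (CrossedProduct hξ) :=
  inferInstanceAs (AddCommGroup ((L ≃ₐ[F] L) → L))

instance : Module F (CrossedProduct hξ) :=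
  inferInstanceAs (Module F ((L ≃ₐ[F] L) → L))

/-- The coefficient of `u_σ`. -/
def coeff (x : CrossedProduct hξ) (σ : L ≃ₐ[F] L) : L := x σ

/-- The element `a u_σ`. -/
noncomputable def single (σ : L ≃ₐ[F] L) (a : L) : CrossedProduct hξ :=
  open Classical in (Pi.single σ a : (L ≃ₐ[F] L) → L)

variable {hξ}

@[ext] theorem ext {x y : CrossedProduct hξ} (h : ∀ σ, coeff hξ x σ = coeff hξ y σ) : x = y :=
  funext h

@[simp] theorem coeff_add (x y : CrossedProduct hξ) (σ : L ≃ₐ[F] L) :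
    coeff hξ (x + y) σ = coeff hξ x σ + coeff hξ y σ := rfl

@[simp] theorem coeff_zero (σ : L ≃ₐ[F] L) : coeff hξ 0 σ = 0 := rfl

@[simp] theorem coeff_smul (c : F) (x : CrossedProduct hξ) (σ : L ≃ₐ[F] L) :
    coeff hξ (c • x) σ = c • coeff hξ x σ := rfl

open Classical in
theorem coeff_single (σ ρ : L ≃ₐ[F] L) (a : L) :
    coeff hξ (single hξ σ a) ρ = if ρ = σ then a else 0 := by
  simp [coeff, single, Pi.single_apply]

/-- The cocycle identity, read in `L`. -/
theorem cocycle (hξ : IsMulCocycle₂ ξ) (σ ρ π : L ≃ₐ[F] L) :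
    (ξ (σ * ρ, π) : L) * ξ (σ, ρ) = σ (ξ (ρ, π)) * ξ (σ, ρ * π) := by
  simpa using congrArg Units.val (hξ σ ρ π)

/-- The unit is `ξ(1, 1)⁻¹ u_1`. -/
noncomputable instance : One (CrossedProduct hξ) where
  one := single hξ 1 ((ξ (1, 1))⁻¹ : Lˣ)

theorem one_def : (1 : CrossedProduct hξ) = single hξ 1 ((ξ (1, 1))⁻¹ : Lˣ) := rfl

variable [FiniteDimensional F L]

/-- `(∑ σ, x_σ u_σ) (∑ ρ, y_ρ u_ρ) = ∑ σ, ∑ ρ, x_σ σ(y_ρ) ξ(σ, ρ) u_{σρ}`. -/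
noncomputable instance : Mul (CrossedProduct hξ) where
  mul x y := fun π => ∑ σ : L ≃ₐ[F] L,
    coeff hξ x σ * σ (coeff hξ y (σ⁻¹ * π)) * ξ (σ, σ⁻¹ * π)

theorem coeff_mul (x y : CrossedProduct hξ) (π : L ≃ₐ[F] L) :
    coeff hξ (x * y) π = ∑ σ : L ≃ₐ[F] L,
      coeff hξ x σ * σ (coeff hξ y (σ⁻¹ * π)) * ξ (σ, σ⁻¹ * π) := rfl

theorem single_mul_single (σ ρ : L ≃ₐ[F] L) (a b : L) :
    single hξ σ a * single hξ ρ b = single hξ (σ * ρ) (a * σ b * ξ (σ, ρ)) := by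
  classical
  ext π
  rw [coeff_mul, Finset.sum_eq_single σ]
  · simp only [coeff_single, if_true, inv_mul_eq_iff_eq_mul]
    split_ifs with h
    · subst h; simp
    · simp
  · intro τ _ hτ
    simp [coeff_single, hτ]
  · simp

noncomputable instance : Ring (CrossedProduct hξ) where
  __ := (inferInstance : AddCommGroup (CrossedProduct hξ))
  __ := (inferInstance : Mul (CrossedProduct hξ))
  __ := (inferInstance : One (CrossedProduct hξ))
  left_distrib x y z := by
    ext π
    simp only [coeff_mul, coeff_add, map_add, mul_add, add_mul, Finset.sum_add_distrib]
  right_distrib x y z := by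
    ext π
    simp only [coeff_mul, coeff_add, add_mul, Finset.sum_add_distrib]
  zero_mul x := by ext π; simp [coeff_mul]
  mul_zero x := by ext π; simp [coeff_mul]
  mul_assoc x y z := by
    ext τ
    simp only [coeff_mul, map_sum, Finset.sum_mul, Finset.mul_sum, map_mul]
    rw [Finset.sum_comm]
    refine Finset.sum_congr rfl fun σ _ => ?_
    refine Fintype.sum_equiv (Equiv.mulLeft σ⁻¹) _ _ fun ρ => ?_
    have h := cocycle hξ σ (σ⁻¹ * ρ) (ρ⁻¹ * τ)
    have e1 : σ * (σ⁻¹ * ρ) = ρ := by group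
    have e2 : σ⁻¹ * ρ * (ρ⁻¹ * τ) = σ⁻¹ * τ := by group
    have e3 : (σ⁻¹ * ρ)⁻¹ * (σ⁻¹ * τ) = ρ⁻¹ * τ := by group
    rw [e1, e2] at h
    simp only [Equiv.coe_mulLeft, e3, ← AlgEquiv.mul_apply, e1]
    linear_combination
      (coeff hξ x σ * σ (coeff hξ y (σ⁻¹ * ρ)) * ρ (coeff hξ z (ρ⁻¹ * τ))) * h
  one_mul x := by
    classical
    ext π
    rw [coeff_mul, Finset.sum_eq_single 1]
    · simp only [one_def, coeff_single, if_true, inv_one, one_mul, AlgEquiv.one_apply]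
      rw [map_one_fst_of_isMulCocycle₂ hξ π, mul_right_comm]
      simp
    · intro σ _ hσ
      simp [one_def, coeff_single, hσ]
    · simp
  mul_one x := by
    classical
    ext π
    rw [coeff_mul, Finset.sum_eq_single π]
    · simp only [one_def, coeff_single, if_true, inv_mul_cancel]
      rw [map_one_snd_of_isMulCocycle₂ hξ π, mul_assoc]
      simp
    · intro σ _ hσ
      have : σ⁻¹ * π ≠ 1 := fun h => hσ (inv_mul_eq_one.1 h)
      simp [one_def, coeff_single, this]
    · simp

noncomputable instance : Algebra F (CrossedProduct hξ) :=
  Algebra.ofModule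
    (fun c x y => by
      ext π
      simp only [coeff_mul, coeff_smul, Finset.smul_sum, smul_mul_assoc])
    (fun c x y => by
      ext π
      simp only [coeff_mul, coeff_smul, Finset.smul_sum, map_smul, smul_mul_assoc,
        mul_smul_comm])

variable (hξ) in
/-- The embedding of `L` as a subfield, `a ↦ a • 1 = a ξ(1, 1)⁻¹ u_1`. -/
noncomputable def ofField : L →ₐ[F] CrossedProduct hξ :=
  AlgHom.ofLinearMap
    { toFun := fun a => single hξ 1 (a * ((ξ (1, 1))⁻¹ : Lˣ))
      map_add' := fun a b => by
        classical
        ext π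
        simp only [coeff_add, coeff_single]
        split_ifs <;> simp [add_mul]
      map_smul' := fun c a => by
        classical
        ext π
        simp only [coeff_smul, coeff_single, RingHom.id_apply]
        split_ifs <;> simp }
    (by simp [one_def])
    (fun a b => by
      simp only [LinearMap.coe_mk, AddHom.coe_mk, single_mul_single, AlgEquiv.one_apply, one_mul]
      congr 1
      have : ((ξ (1, 1))⁻¹ : Lˣ) * (ξ (1, 1) : L) = 1 := Units.inv_mul _
      linear_combination (-(a * b * ((ξ (1, 1))⁻¹ : Lˣ))) * this)

/-- The defining relation `u_σ a = σ(a) u_σ`. -/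
theorem single_mul_ofField (σ : L ≃ₐ[F] L) (a : L) :
    single hξ σ 1 * ofField hξ a = ofField hξ (σ a) * single hξ σ 1 := by
  simp only [ofField, AlgHom.ofLinearMap_apply, LinearMap.coe_mk, AddHom.coe_mk,
    single_mul_single, mul_one, one_mul]
  congr 1
  rw [map_one_fst_of_isMulCocycle₂ hξ σ, map_one_snd_of_isMulCocycle₂ hξ σ]
  have h1 : ((ξ (1, 1))⁻¹ : Lˣ) * (ξ (1, 1) : L) = 1 := Units.inv_mul _
  have h2 := congrArg σ h1
  simp only [map_mul, map_one] at h2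
  simp only [map_mul, AlgEquiv.smul_units_def, Units.coe_map, MonoidHom.coe_coe, map_one, mul_one]
  linear_combination (σ a) * h2 - (σ a) * h1

/-- The defining relation `u_σ u_ρ = ξ(σ, ρ) u_{σρ}`. -/
theorem single_mul_single_one (σ ρ : L ≃ₐ[F] L) :
    single hξ σ 1 * single hξ ρ 1 = ofField hξ (ξ (σ, ρ)) * single hξ (σ * ρ) 1 := by
  simp only [ofField, AlgHom.ofLinearMap_apply, LinearMap.coe_mk, AddHom.coe_mk,
    single_mul_single, mul_one, one_mul, map_one]
  congr 1
  rw [map_one_fst_of_isMulCocycle₂ hξ (σ * ρ)]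
  simp

end

end CrossedProduct

/-- `T` is a reduced trace of the `F`-algebra `B`: for a splitting
`φ : Ω ⊗ B ≃ Mₙ(Ω)` over the algebraic closure `Ω` of `F`, one has `T b = tr (φ (1 ⊗ b))`.
Every central simple algebra has a unique such `T`. -/
def IsReducedTrace (F B : Type*) [Field F] [Ring B] [Algebra F B] (T : B →ₗ[F] F) : Prop :=
  ∃ (n : ℕ) (φ : AlgebraicClosure F ⊗[F] B ≃ₐ[AlgebraicClosure F]
      Matrix (Fin n) (Fin n) (AlgebraicClosure F)),
    ∀ b : B, algebraMap F (AlgebraicClosure F) (T b) = (φ (1 ⊗ₜ[F] b)).trace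

/-- The reduced trace does not depend on the splitting. -/
theorem IsReducedTrace.eq {F B : Type*} [Field F] [Ring B] [Algebra F B] {T T' : B →ₗ[F] F}
    (h : IsReducedTrace F B T) (h' : IsReducedTrace F B T') : T = T' := by
  obtain ⟨n, φ, hφ⟩ := h
  obtain ⟨m, ψ, hψ⟩ := h'
  ext b
  apply (algebraMap F (AlgebraicClosure F)).injective
  rw [hφ, hψ, ← Matrix.trace_map (φ.symm.trans ψ) (φ (1 ⊗ₜ[F] b))]
  simp

open Classical in
/-- The reduced trace `Trd_B : B → F` of a central simple `F`-algebra `B`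
(zero if `B` has no reduced trace). -/
noncomputable def reducedTrace (F B : Type*) [Field F] [Ring B] [Algebra F B] : B →ₗ[F] F :=
  if h : ∃ T : B →ₗ[F] F, IsReducedTrace F B T then h.choose else 0

theorem IsReducedTrace.reducedTrace_eq {F B : Type*} [Field F] [Ring B] [Algebra F B]
    {T : B →ₗ[F] F} (h : IsReducedTrace F B T) : reducedTrace F B = T := by
  have hex : ∃ T : B →ₗ[F] F, IsReducedTrace F B T := ⟨T, h⟩
  rw [reducedTrace, dif_pos hex]
  exact hex.choose_spec.eq h

/-- For an automorphism `c` of order two of `F` with fixed field `F₀`: `τ` is a unitary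
`F/F₀`-involution on the `F`-algebra `B`, i.e. a ring anti-automorphism of `B` with `τ² = id`
that restricts to `c` on `F`. -/
structure IsUnitaryInvolution {F B : Type*} [Field F] [Ring B] [Algebra F B]
    (c : F → F) (τ : B → B) : Prop where
  map_add : ∀ x y, τ (x + y) = τ x + τ y
  map_mul : ∀ x y, τ (x * y) = τ y * τ x
  involutive : ∀ x, τ (τ x) = x
  map_algebraMap : ∀ a : F, τ (algebraMap F B a) = algebraMap F B (c a)

/-- For a field `F` embedded in `ℂ` by `j` and a unitary involution `τ` on the central simple
`F`-algebra `B` inducing complex conjugation on `F`: the involution trace form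
`x ↦ Trd_B (τ x * x)` is positive definite for the ordering of the fixed field of complex
conjugation in `F` that is induced from `ℝ`.  The values of this form are fixed by complex
conjugation, hence real, so their sign is that of their real part. -/
def IsPositiveInvolution {F B : Type*} [Field F] [Ring B] [Algebra F B] (j : F →+* ℂ)
    (τ : B → B) : Prop :=
  ∀ x : B, x ≠ 0 → 0 < (j (reducedTrace F B (τ x * x))).re

/-! For `x` in `L`, `Trd_B (τ x * x)` equals `Tr_{L/k} (α x * x)` (`reducedTrace_ofField`). With `s
ρ = α ρ α`, this is the value of the form `z ↦ ∑ ρ, conj (z (s ρ)) * z ρ` at the vector of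
conjugates `z ρ = ι (ρ x)`. As `k` is not real, it is dense in `ℂ`; together with Dedekind
independence this makes the vectors of conjugates dense in the space of all functions `G → ℂ`
(`denseRange_conjugates`). Positivity thus passes to the limit: the form is nonnegative everywhere.
If `s σ ≠ σ`, it takes the value `-2` at `e_σ - e_{s σ}`, so `s` is the identity. -/

/-! ### Dedekind independence -/

/-- The conjugates of the elements of `L` under a group of automorphisms span the space of
all functions on the group (Dedekind). -/
theorem span_range_conjugates_eq_top {F L K : Type*} [Field F] [Field L] [Algebra F L] [Field K]
    [FiniteDimensional F L] (j : L →+* K) :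
    Submodule.span K (Set.range fun (x : L) (σ : L ≃ₐ[F] L) => j (σ x)) = ⊤ := by
  classical
  by_contra hne
  obtain ⟨f, hf0, hf⟩ := Submodule.exists_le_ker_of_lt_top _ (lt_top_iff_ne_top.2 hne)
  apply hf0
  have hinj : Function.Injective
      (fun σ : L ≃ₐ[F] L => ((j.comp (σ : L →+* L) : L →+* K) : L →* K)) := by
    intro σ ρ h
    ext x
    exact j.injective (DFunLike.congr_fun h x)
  have hli := (linearIndependent_monoidHom L K).comp _ hinj
  rw [Fintype.linearIndependent_iff] at hli
  -- A functional killing all vectors of conjugates is a linear relation between the distinct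
  -- characters `j ∘ σ`, with coefficients `f e_σ`.
  have h0 := hli (fun σ => f (Pi.single σ 1)) (by
    ext x
    have hx : f (fun σ : L ≃ₐ[F] L => j (σ x)) = 0 := hf (Submodule.subset_span ⟨x, rfl⟩)
    rw [LinearMap.pi_apply_eq_sum_univ] at hx
    simp only [Finset.sum_apply, Pi.smul_apply, Pi.zero_apply, smul_eq_mul]
    rw [← hx]
    refine Finset.sum_congr rfl fun σ _ => ?_
    rw [smul_eq_mul, mul_comm]
    congr 2
    ext ρ
    simp [Pi.single_apply, eq_comm])
  refine LinearMap.pi_ext' fun σ => LinearMap.ext_ring ?_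
  simpa using h0 σ

/-! ### Splitting and reduced trace of a crossed product -/

namespace CrossedProduct

variable {F L : Type*} [Field F] [Field L] [Algebra F L] [FiniteDimensional F L]
  {ξ : (L ≃ₐ[F] L) × (L ≃ₐ[F] L) → Lˣ}

/-- Left multiplication on the crossed product as a right `L`-vector space with basis `(u_σ)`,
in matrix form, with entries mapped to an extension `Ω` of `F`. -/
noncomputable def regularMatrix [DecidableEq (L ≃ₐ[F] L)]
    (hξ : IsMulCocycle₂ ξ) {Ω : Type*} [Field Ω] [Algebra F Ω]
    (j : L →ₐ[F] Ω) : CrossedProduct hξ →ₐ[F] Matrix (L ≃ₐ[F] L) (L ≃ₐ[F] L) Ω :=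
  AlgHom.ofLinearMap
    -- `b u_ρ` has `u_σ`-term `a u_σ` with `a = b_{σρ⁻¹} ξ(σρ⁻¹, ρ)`; moving `a` to the right of
    -- `u_σ` turns it into `σ⁻¹ a`.
    { toFun := fun b : CrossedProduct hξ => Matrix.of fun σ ρ : L ≃ₐ[F] L =>
        j (σ⁻¹ (coeff hξ b (σ * ρ⁻¹) * ξ (σ * ρ⁻¹, ρ)))
      map_add' := fun a b => by
        ext σ ρ
        simp [add_mul]
      map_smul' := fun c a => by
        ext σ ρ
        simp only [Matrix.of_apply, coeff_smul, smul_mul_assoc, map_smul, Matrix.smul_apply,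
          RingHom.id_apply] }
    (by
      ext σ ρ
      simp only [LinearMap.coe_mk, AddHom.coe_mk, Matrix.of_apply, one_def, coeff_single,
        mul_inv_eq_one, Matrix.one_apply]
      split_ifs with h
      · subst h
        rw [mul_inv_cancel, map_one_fst_of_isMulCocycle₂ hξ σ, Units.inv_mul, map_one, map_one]
      · simp)
    (fun a b => by
      ext σ ρ
      simp only [LinearMap.coe_mk, AddHom.coe_mk, Matrix.of_apply, Matrix.mul_apply, coeff_mul,
        Finset.sum_mul, map_sum]
      refine Fintype.sum_equiv ((Equiv.inv _).trans (Equiv.mulRight σ)) _ _ fun π => ?_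
      have e1 : σ * (π⁻¹ * σ)⁻¹ = π := by group
      have e2 : π⁻¹ * σ * ρ⁻¹ = π⁻¹ * (σ * ρ⁻¹) := by group
      have e3 : π * (π⁻¹ * (σ * ρ⁻¹)) = σ * ρ⁻¹ := by group
      have e4 : π⁻¹ * (σ * ρ⁻¹) * ρ = π⁻¹ * σ := by group
      have e5 : ∀ y, (π⁻¹ * σ)⁻¹ y = σ⁻¹ (π y) := fun y => by
        rw [mul_inv_rev, inv_inv]; rfl
      have h := cocycle hξ π (π⁻¹ * (σ * ρ⁻¹)) ρ
      rw [e3, e4] at h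
      simp only [Equiv.trans_apply, Equiv.inv_apply, Equiv.coe_mulRight, e1, e2, e5]
      rw [← map_mul, ← map_mul]
      congr 2
      rw [map_mul]
      linear_combination (coeff hξ a π * π (coeff hξ b (π⁻¹ * (σ * ρ⁻¹)))) * h)

theorem regularMatrix_apply [DecidableEq (L ≃ₐ[F] L)]
    (hξ : IsMulCocycle₂ ξ) {Ω : Type*} [Field Ω] [Algebra F Ω]
    (j : L →ₐ[F] Ω) (b : CrossedProduct hξ) (σ ρ : L ≃ₐ[F] L) :
    regularMatrix hξ j b σ ρ = j (σ⁻¹ (coeff hξ b (σ * ρ⁻¹) * ξ (σ * ρ⁻¹, ρ))) := rfl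

theorem trace_regularMatrix [DecidableEq (L ≃ₐ[F] L)]
    [IsGalois F L] (hξ : IsMulCocycle₂ ξ) {Ω : Type*} [Field Ω]
    [Algebra F Ω] (j : L →ₐ[F] Ω) (b : CrossedProduct hξ) :
    (regularMatrix hξ j b).trace =
      algebraMap F Ω (Algebra.trace F L (coeff hξ b 1 * ξ (1, 1))) := by
  rw [← j.commutes, trace_eq_sum_automorphisms, map_sum, Matrix.trace]
  refine Fintype.sum_equiv (Equiv.inv _) _ _ fun σ => ?_
  rw [Matrix.diag_apply, regularMatrix_apply, mul_inv_cancel, map_one_fst_of_isMulCocycle₂ hξ σ]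
  rfl

/-- The matrix of `a u_τ` lives on the positions `(σ, τ⁻¹σ)`, one per row, with entries the
conjugates `σ⁻¹ a` up to nonzero factors independent of `a`. Dedekind independence fills each such
set of positions. -/
theorem span_range_regularMatrix_eq_top [DecidableEq (L ≃ₐ[F] L)]
    (hξ : IsMulCocycle₂ ξ) {Ω : Type*} [Field Ω]
    [Algebra F Ω] (j : L →ₐ[F] Ω) :
    Submodule.span Ω (Set.range (regularMatrix hξ j)) = ⊤ := by
  by_contra hne
  obtain ⟨f, hf0, hf⟩ := Submodule.exists_le_ker_of_lt_top _ (lt_top_iff_ne_top.2 hne)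
  apply hf0
  -- the restriction of `f` to the matrices supported on the positions `(τ * ρ, ρ)`
  have key : ∀ τ : L ≃ₐ[F] L, ∀ σ ρ, σ * ρ⁻¹ = τ → f (Matrix.single σ ρ 1) = 0 := by
    intro τ
    -- Chosen so that `g` at the vector of conjugates of `a` is `f` at the matrix of `a u_τ`; row
    -- `σ` carries `σ⁻¹ a`, whence the projection at `σ⁻¹`.
    let g : ((L ≃ₐ[F] L) → Ω) →ₗ[Ω] Ω :=
      ∑ σ, (j (σ⁻¹ (ξ (τ, τ⁻¹ * σ))) * f (Matrix.single σ (τ⁻¹ * σ) 1)) • LinearMap.proj σ⁻¹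
    have hg : g = 0 := by
      rw [← LinearMap.ker_eq_top, eq_top_iff, ← span_range_conjugates_eq_top (j : L →+* Ω),
        Submodule.span_le]
      rintro _ ⟨a, rfl⟩
      have ha : f (regularMatrix hξ j (single hξ τ a)) = 0 := hf (Submodule.subset_span ⟨_, rfl⟩)
      rw [Matrix.matrix_eq_sum_single (regularMatrix hξ j (single hξ τ a))] at ha
      simp only [map_sum] at ha
      rw [SetLike.mem_coe, LinearMap.mem_ker, ← ha]
      simp only [g, LinearMap.sum_apply, LinearMap.smul_apply, LinearMap.proj_apply, smul_eq_mul]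
      refine Finset.sum_congr rfl fun σ _ => ?_
      have hs : ∀ ρ, Matrix.single σ ρ (regularMatrix hξ j (single hξ τ a) σ ρ) =
          (regularMatrix hξ j (single hξ τ a) σ ρ) • Matrix.single σ ρ (1 : Ω) := by
        intro ρ; simp
      simp only [hs, map_smul]
      rw [Finset.sum_eq_single (τ⁻¹ * σ)]
      · have e : σ * (τ⁻¹ * σ)⁻¹ = τ := by group
        rw [regularMatrix_apply, e]
        simp only [coeff_single, if_true, map_mul, smul_eq_mul, AlgHom.coe_toRingHom]
        ring
      · intro ρ _ hρ
        have : σ * ρ⁻¹ ≠ τ := by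
          rintro rfl
          exact hρ (by group)
        simp [regularMatrix_apply, coeff_single, this]
      · simp
    rintro σ ρ rfl
    have h := LinearMap.congr_fun hg (Pi.single σ⁻¹ 1)
    simp only [g, LinearMap.sum_apply, LinearMap.smul_apply, LinearMap.proj_apply, smul_eq_mul,
      LinearMap.zero_apply] at h
    rw [Finset.sum_eq_single σ] at h
    · have e : (σ * ρ⁻¹)⁻¹ * σ = ρ := by group
      simpa [e] using h
    · intro π _ hπ
      simp [hπ]
    · simp
  refine Matrix.ext_linearMap _ fun σ ρ => LinearMap.ext_ring ?_
  simpa using key _ σ ρ rfl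

instance (hξ : IsMulCocycle₂ ξ) : FiniteDimensional F (CrossedProduct hξ) :=
  inferInstanceAs (FiniteDimensional F ((L ≃ₐ[F] L) → L))

theorem finrank_eq [IsGalois F L] (hξ : IsMulCocycle₂ ξ) :
    Module.finrank F (CrossedProduct hξ) =
      Fintype.card (L ≃ₐ[F] L) * Fintype.card (L ≃ₐ[F] L) := by
  have h : Module.finrank F ((L ≃ₐ[F] L) → L) =
      Fintype.card (L ≃ₐ[F] L) * Module.finrank F L := by
    rw [Module.finrank_pi_fintype]; simp
  rw [← IsGalois.card_aut_eq_finrank, Nat.card_eq_fintype_card] at h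
  exact h

/-- Spanning gives surjectivity, and both sides have dimension `|G|²` over `Ω`. -/
theorem lift_regularMatrix_bijective [DecidableEq (L ≃ₐ[F] L)]
    [IsGalois F L] (hξ : IsMulCocycle₂ ξ) {Ω : Type*} [Field Ω]
    [Algebra F Ω] (j : L →ₐ[F] Ω) :
    Function.Bijective (AlgHom.liftEquiv F Ω _ _ (regularMatrix hξ j)) := by
  classical
  set Φ := AlgHom.liftEquiv F Ω _ _ (regularMatrix hξ j)
  have hsurj : Function.Surjective Φ.toLinearMap := by
    rw [← LinearMap.range_eq_top, eq_top_iff, ← span_range_regularMatrix_eq_top hξ j,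
      Submodule.span_le]
    rintro _ ⟨b, rfl⟩
    exact ⟨1 ⊗ₜ b, by simp [Φ]⟩
  refine ⟨?_, hsurj⟩
  refine (LinearMap.injective_iff_surjective_of_finrank_eq_finrank (f := Φ.toLinearMap) ?_).2 hsurj
  rw [Module.finrank_baseChange, finrank_eq, Module.finrank_matrix, Module.finrank_self, mul_one]

variable (F L) in
/-- The linear form `∑ σ, x_σ u_σ ↦ Tr_{L/F} (x_1 ξ(1, 1))` on the crossed product. -/
noncomputable def traceForm (hξ : IsMulCocycle₂ ξ) : CrossedProduct hξ →ₗ[F] F :=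
  Algebra.trace F L ∘ₗ
    { toFun := fun b => coeff hξ b 1 * ξ (1, 1)
      map_add' := fun a b => by simp [add_mul]
      map_smul' := fun c a => by simp }

theorem isReducedTrace_traceForm [IsGalois F L] (hξ : IsMulCocycle₂ ξ) :
    IsReducedTrace F (CrossedProduct hξ) (traceForm F L hξ) := by
  classical
  let j : L →ₐ[F] AlgebraicClosure F := IsAlgClosed.lift
  refine ⟨Fintype.card (L ≃ₐ[F] L),
    (AlgEquiv.ofBijective _ (lift_regularMatrix_bijective hξ j)).trans
      (Matrix.reindexAlgEquiv _ _ (Fintype.equivFin _)), fun b => ?_⟩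
  have h : (AlgEquiv.ofBijective _ (lift_regularMatrix_bijective hξ j)) (1 ⊗ₜ[F] b) =
      regularMatrix hξ j b := by simp
  rw [AlgEquiv.trans_apply, h, Matrix.coe_reindexAlgEquiv, Matrix.reindex_apply]
  refine (trace_regularMatrix hξ j b).symm.trans ?_
  exact (Equiv.sum_comp (Fintype.equivFin _).symm fun σ => regularMatrix hξ j b σ σ).symm

/-- On the maximal subfield `L`, the reduced trace of the crossed product is the field trace. -/
theorem reducedTrace_ofField [IsGalois F L] (hξ : IsMulCocycle₂ ξ) (a : L) :
    reducedTrace F (CrossedProduct hξ) (ofField hξ a) = Algebra.trace F L a := by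
  rw [(isReducedTrace_traceForm hξ).reducedTrace_eq]
  change Algebra.trace F L (coeff hξ (single hξ 1 (a * ((ξ (1, 1))⁻¹ : Lˣ))) 1 * ξ (1, 1)) = _
  rw [coeff_single, if_pos rfl, mul_assoc, Units.inv_mul, mul_one]

theorem ofField_injective (hξ : IsMulCocycle₂ ξ) : Function.Injective (ofField hξ) := by
  intro a b h
  have h1 : coeff hξ (single hξ 1 (a * ((ξ (1, 1))⁻¹ : Lˣ))) 1 =
      coeff hξ (single hξ 1 (b * ((ξ (1, 1))⁻¹ : Lˣ))) 1 := congrArg (fun x => coeff hξ x 1) h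
  rw [coeff_single, coeff_single, if_pos rfl, if_pos rfl] at h1
  exact mul_right_cancel₀ (Units.ne_zero _) h1

end CrossedProduct

/-! ### Density in `ℂ` and the positivity argument -/

/-- A field homomorphism to `ℂ` that takes a non-real value has dense range. -/
theorem Complex.denseRange_of_conj_ne {K : Type*} [Field K] (j : K →+* ℂ) {a : K}
    (ha : starRingEnd ℂ (j a) ≠ j a) : DenseRange j := by
  -- The only closed subfields of `ℂ` are `ℝ` and `ℂ`.
  rcases Complex.subfield_eq_of_closed j.fieldRange.isClosed_topologicalClosure with h | h
  · have hmem : j a ∈ j.fieldRange.topologicalClosure :=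
      j.fieldRange.le_topologicalClosure ⟨a, rfl⟩
    rw [h] at hmem
    obtain ⟨r, hr⟩ := hmem
    exact absurd (by rw [← hr]; exact Complex.conj_ofReal r) ha
  · have h' := congrArg (fun S : Subfield ℂ => (S : Set ℂ)) h
    rw [DenseRange, dense_iff_closure_eq]
    exact h'

/-- Weak approximation at the complex places above a fixed complex place. -/
theorem denseRange_conjugates {F L : Type*} [Field F] [Field L] [Algebra F L]
    [FiniteDimensional F L] (ι : L →+* ℂ) (hd : DenseRange (ι.comp (algebraMap F L))) :
    DenseRange fun (x : L) (σ : L ≃ₐ[F] L) => ι (σ x) := by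
  intro z
  have hz : z ∈ Submodule.span ℂ (Set.range fun (x : L) (σ : L ≃ₐ[F] L) => ι (σ x)) := by
    rw [span_range_conjugates_eq_top]; trivial
  -- The closure of the vectors of conjugates is a complex subspace: it is stable under `F` because
  -- each `σ` fixes `F`, hence under `ℂ` by density of `F`.
  induction hz using Submodule.span_induction with
  | mem x hx => exact subset_closure hx
  | zero => exact subset_closure ⟨0, by ext; simp⟩
  | add x y _ _ hx hy =>
    refine map_mem_closure₂ continuous_add hx hy ?_
    rintro _ ⟨a, rfl⟩ _ ⟨b, rfl⟩
    exact ⟨a + b, by ext; simp⟩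
  | smul c x _ hx =>
    refine map_mem_closure₂ continuous_smul (hd c) hx ?_
    rintro _ ⟨a, rfl⟩ _ ⟨b, rfl⟩
    exact ⟨algebraMap F L a * b, by ext; simp⟩

/-- If complex conjugation induces an automorphism `α` of `L ⊆ ℂ` and the hermitian trace form
`x ↦ Tr (α x * x)` over a non-real subfield is positive, then `α` is central in the
Galois group. -/
theorem conj_comm_of_trace_nonneg {F L : Type*} [Field F] [Field L] [Algebra F L]
    [FiniteDimensional F L] [IsGalois F L] (ι : L →+* ℂ)
    (hd : DenseRange (ι.comp (algebraMap F L))) (c : F → F) (α : L ≃+* L)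
    (hα : ∀ x : L, ι (α x) = starRingEnd ℂ (ι x))
    (hαc : ∀ a : F, α (algebraMap F L a) = algebraMap F L (c a))
    (hpos : ∀ x : L, 0 ≤ (ι (algebraMap F L (Algebra.trace F L (α x * x)))).re)
    (σ : L ≃ₐ[F] L) (x : L) : α (σ x) = σ (α x) := by
  classical
  have hαα : ∀ x, α (α x) = x := fun x => ι.injective (by simp [hα])
  have hex : ∀ ρ : L ≃ₐ[F] L, ∃ ρ' : L ≃ₐ[F] L, ∀ x, ρ' x = α (ρ (α x)) := fun ρ =>
    ⟨AlgEquiv.ofRingEquiv (f := (α.trans (ρ : L ≃+* L)).trans α) (fun a => by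
      change α (ρ (α (algebraMap F L a))) = _
      rw [hαc, ρ.commutes, ← hαc, hαα]), fun _ => rfl⟩
  choose s hs using hex
  have hss : ∀ ρ, s (s ρ) = ρ := fun ρ => by
    ext x; simp [hs, hαα]
  suffices h : s σ = σ by
    have := hs σ x
    rw [h] at this
    rw [← hαα (σ (α x)), ← this]
  by_contra hne
  have hform : ∀ z : (L ≃ₐ[F] L) → ℂ, 0 ≤ (∑ ρ, starRingEnd ℂ (z (s ρ)) * z ρ).re := by
    intro z
    refine (denseRange_conjugates ι hd).induction_on z
      (p := fun z => 0 ≤ (∑ ρ, starRingEnd ℂ (z (s ρ)) * z ρ).re) ?_ fun y => ?_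
    · exact isClosed_le continuous_const (by fun_prop)
    · have h := hpos y
      rw [trace_eq_sum_automorphisms, map_sum] at h
      convert h using 3 with ρ
      change starRingEnd ℂ (ι (s ρ y)) * ι (ρ y) = _
      rw [map_mul, map_mul, hs, hα, Complex.conj_conj]
  -- On the plane spanned by `e_σ` and `e_{s σ}` the involution `s` swaps coordinates, so the form
  -- is hyperbolic there and this vector is negative.
  have h := hform (fun ρ => (if ρ = σ then 1 else 0) - (if ρ = s σ then 1 else 0))
  have hiff : ∀ ρ, s ρ = σ ↔ ρ = s σ :=
    fun ρ => ⟨fun h => by rw [← h, hss], fun h => by rw [h, hss]⟩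
  have hiff' : ∀ ρ, s ρ = s σ ↔ ρ = σ :=
    fun ρ => ⟨fun h => by rw [← hss ρ, h, hss], fun h => by rw [h]⟩
  have hsum : ∑ ρ : L ≃ₐ[F] L,
      starRingEnd ℂ ((if s ρ = σ then 1 else 0) - (if s ρ = s σ then 1 else 0)) *
        ((if ρ = σ then 1 else 0) - (if ρ = s σ then 1 else 0)) = (-2 : ℂ) := by
    have ht : ∀ ρ : L ≃ₐ[F] L,
        starRingEnd ℂ ((if s ρ = σ then 1 else 0) - (if s ρ = s σ then 1 else 0)) *
          ((if ρ = σ then 1 else 0) - (if ρ = s σ then 1 else 0)) =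
        ((if ρ = σ then -1 else 0) + (if ρ = s σ then -1 else 0) : ℂ) := by
      intro ρ
      simp only [hiff, hiff']
      by_cases h1 : ρ = σ
      · have h2 : ρ ≠ s σ := fun h => hne (h.symm.trans h1)
        simp [h1, Ne.symm hne]
      · by_cases h2 : ρ = s σ <;> simp [h1, h2, hne]
    rw [Finset.sum_congr rfl fun ρ _ => ht ρ, Finset.sum_add_distrib]
    simp
    norm_num
  rw [hsum] at h
  norm_num at h

theorem proposition3p1
    {k₀ k L : Type*} [Field k₀] [NumberField k₀] [Field k] [NumberField k] [Field L]
    [Algebra k₀ k] (hk : Module.finrank k₀ k = 2)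
    [Algebra k L] [FiniteDimensional k L] [IsGalois k L]
    -- `L` (and with it `k` and `k₀`) is a subfield of `ℂ`
    (ι : L →+* ℂ)
    -- the nontrivial automorphism `c` of `k / k₀` is complex conjugation
    (c : k ≃ₐ[k₀] k) (hc_ne : c ≠ 1)
    (hc : ∀ a : k, ι (algebraMap k L (c a)) = starRingEnd ℂ (ι (algebraMap k L a)))
    -- complex conjugation induces the automorphism `α` of `L`
    (α : L ≃+* L) (hα : ∀ x : L, ι (α x) = starRingEnd ℂ (ι x))
    (ξ : (L ≃ₐ[k] L) × (L ≃ₐ[k] L) → Lˣ) (hξ : groupCohomology.IsMulCocycle₂ ξ)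
    (hξα : ∀ σ ρ : L ≃ₐ[k] L, α (ξ (σ, ρ) : L) * (ξ (σ, ρ) : L) = 1)
    -- the crossed product `B = (ξ, L/k, Gal(L/k))` is a division algebra
    (hdiv : ∀ b : CrossedProduct hξ, b ≠ 0 → IsUnit b)
    -- `τ` is a positive unitary `k / k₀`-involution on `B` that restricts to `α` on `L`
    (τ : CrossedProduct hξ → CrossedProduct hξ)
    (hτ : IsUnitaryInvolution c τ)
    (hpos : IsPositiveInvolution (ι.comp (algebraMap k L)) τ)
    (hτα : ∀ x : L, τ (CrossedProduct.ofField hξ x) = CrossedProduct.ofField hξ (α x)) :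
    ∀ (σ : L ≃ₐ[k] L) (x : L), α (σ x) = σ (α x) := by
  have hαc : ∀ a : k, α (algebraMap k L a) = algebraMap k L (c a) :=
    fun a => ι.injective (by rw [hα, hc])
  obtain ⟨a, ha⟩ : ∃ a, c a ≠ a := by
    by_contra! h
    exact hc_ne (AlgEquiv.ext h)
  have hd : DenseRange (ι.comp (algebraMap k L)) := by
    refine Complex.denseRange_of_conj_ne (a := a) _ fun h => ha ?_
    rw [RingHom.comp_apply, ← hc] at h
    exact (algebraMap k L).injective (ι.injective h)
  refine conj_comm_of_trace_nonneg ι hd c α hα hαc fun x => ?_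
  rcases eq_or_ne x 0 with rfl | hx
  · simp
  -- Positivity of `τ` is needed only on the subfield `L`, where `τ` is `α`.
  · have h := hpos (CrossedProduct.ofField hξ x) (by
      rwa [Ne, map_eq_zero_iff _ (CrossedProduct.ofField_injective hξ)])
    rw [hτα, ← map_mul, CrossedProduct.reducedTrace_ofField] at h
    exact h.le
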